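/- All graphs are finite and simple; $\mathrm d_\Gamma$ is the graph distance. A set $R$ of vertices of a connected graph $\Gamma$ is a *resolving set* if for any two distinct vertices $u,w$ there is $v\in R$ with $\mathrm d_\Gamma(u,v)\ne \mathrm d_\Gamma(w,v)$, and the *metric dimension* $\mu(\Gamma)$ is the smallest size of a resolving set. A connected graph $\Gamma$ is *distance-regular* if for all vertices $u,v$ with $\mathrm d_\Gamma(u,v)=i$, the numbers of neighbours of $v$ at distances $i-1$, $i$ and $i+1$ from $u$ depend only on $i$. The *distance-$i$ graph* of $\Gamma$ has the same vertices, two of them being adjacent iff they are at distance $i$ in $\Gamma$. A distance-regular graph of diameter $d$ is *primitive* if its distance-$i$ graph is connected for every $0<i\le d$. The *halved graphs* of a bipartite distance-regular graph are the (two) connected components of its distance-$2$ graph. Let $\Gamma$ be a bipartite distance-regular graph with $n$ vertices and diameter $d\ge 4$ whose halved graphs are primitive and have diameter at least $2$. Let $M(\Gamma)$ be the maximum, over all vertices $v$ and all $i$, of the number of vertices at distance $i$ from $v$, and let $\log$ be the natural logarithm. Then (i) $\displaystyle \mu(\Gamma) < 2\sqrt{2n}\,\log(n/2)$; (ii) $\displaystyle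 \mu(\Gamma) < d\,\frac{n}{n-2M(\Gamma)}\,\log(n/2)$. -/

import Mathlib

namespace SimpleGraph

variable {V : Type*}

/-- `R` is a resolving set for `G`: distinct vertices are told apart by their distances to
the members of `R`. -/
def IsResolvingSet (G : SimpleGraph V) (R : Finset V) : Prop :=
  ∀ u w : V, u ≠ w → ∃ v ∈ R, G.dist u v ≠ G.dist w v

/-- The metric dimension of `G` is the smallest size of a resolving set. (In a finite connected
graph the set of all vertices is resolving, so this is the minimum of a nonempty set.) -/
noncomputable def metricDim (G : SimpleGraph V) : ℕ :=
  sInf {m : ℕ | ∃ R : Finset V, G.IsResolvingSet R ∧ R.card = m}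

/-- `G` is distance-regular: it is connected and, for vertices `u`, `v` at distance `i`, the
number of neighbours of `v` at distance `j` from `u` depends only on `i`, for every `j`
(only `j = i - 1`, `i`, `i + 1` matter, since for other `j` there are no such neighbours). -/
def IsDistanceRegular (G : SimpleGraph V) : Prop :=
  G.Connected ∧ ∀ u v u' v' : V, G.dist u v = G.dist u' v' → ∀ j : ℕ,
    {w : V | G.Adj v w ∧ G.dist u w = j}.ncard = {w : V | G.Adj v' w ∧ G.dist u' w = j}.ncard

/-- The distance-`i` graph of `G`: two distinct vertices are adjacent iff they are at
distance `i` in `G`. -/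
def distanceGraph (G : SimpleGraph V) (i : ℕ) : SimpleGraph V where
  Adj u v := u ≠ v ∧ G.dist u v = i
  symm := ⟨fun _ _ h => ⟨h.1.symm, G.dist_comm ▸ h.2⟩⟩
  loopless := ⟨fun _ h => h.1 rfl⟩

/-- Primitivity of a (distance-regular) graph of diameter `d`: for each `0 < i ≤ d` the
distance-`i` graph is connected. -/
def IsPrimitive (G : SimpleGraph V) : Prop :=
  ∀ i : ℕ, 0 < i → i ≤ G.diam → (G.distanceGraph i).Connected

/-- The halved graphs of `G` are the connected components of its distance-`2` graph. -/
abbrev HalvedIndex (G : SimpleGraph V) : Type _ :=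
  (G.distanceGraph 2).ConnectedComponent

/-- The halved graph given by a connected component `C` of the distance-`2` graph: the graph
induced on `C` by the distance-`2` graph. -/
abbrev halvedGraph (G : SimpleGraph V) (C : G.HalvedIndex) : SimpleGraph C.supp :=
  (G.distanceGraph 2).induce C.supp

/-- The maximum size of a set of vertices at a given distance from a vertex of `G`. -/
noncomputable def maxSphereCard [Fintype V] (G : SimpleGraph V) : ℕ :=
  Finset.univ.sup fun v : V =>
    (Finset.range (G.diam + 1)).sup fun i : ℕ => {w : V | G.dist v w = i}.ncard

end SimpleGraph

/-!
A set of pairs, each resolved by at least `x * n` of the `n` vertices, has by averaging a set of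
`k` vertices leaving at most a proportion `(1 - x) ^ k` of the pairs unresolved. In a bipartite
graph two vertices at odd distance are resolved by every vertex, so only the pairs inside the two
halves matter. It remains to bound from below the number of vertices resolving `u` and `w` in
the same half `C`, when all the distance relations on `C` are connected.

* Let `γ` be the number of vertices of `C` resolving `u` and `w`, and `a = d(u, w)`. Counting the
  pairs at distance `a` that are resolved by a vertex, `2 (|C| - 1) ≤ k_a γ`, where `k_a` is the
  valency of the distance-`a` relation. If `k_a < 2 γ` this gives `|C| ≤ γ ^ 2`. Otherwise every
  two vertices of `C` are resolved by at most `2 γ` vertices of `C`, which forces `|C| - k_a < γ`;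
  some, hence every, pair at distance `a` has a common neighbour in the complement of that
  relation, so `k_a ≤ (|C| - k_a) ^ 2` and again `|C| ≤ γ ^ 2`.
* A pair in `C` is joined by a path of at most `d / 2` steps of distance `a`, so it is resolved by
  at most `d / 2` times as many vertices as `u` and `w` are. For given `u` and `z` the vertices `v`
  with `d(v, z) = d(u, z)` form a sphere around `z`, so averaging over `v ∈ C` some pair in `C` is
  resolved by at least `n (1 - M / |C|)` vertices.
-/

open SimpleGraph
open scoped Finset

section GraphDistance

variable {X : Type*} {H : SimpleGraph X}

theorem exists_adj_dist_eq (hH : H.Connected) {u w : X} {j : ℕ} (h : H.dist u w = j + 1) :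
    ∃ v, H.Adj v w ∧ H.dist u v = j := by
  obtain ⟨p, hp⟩ := hH.exists_walk_length_eq_dist w u
  rw [dist_comm, h] at hp
  cases p with
  | nil => simp at hp
  | @cons _ v _ hadj p =>
    rw [Walk.length_cons, Nat.add_right_cancel_iff] at hp
    have hadj' : H.Adj v w := H.adj_symm hadj
    have hle : H.dist v u ≤ j := hp ▸ dist_le p
    have hge : H.dist u w ≤ H.dist u v + H.dist v w := hH.dist_triangle
    rw [dist_eq_one_iff_adj.2 hadj', dist_comm (u := u) (v := v)] at hge
    exact ⟨v, hadj', by rw [dist_comm]; lia⟩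

theorem exists_dist_eq_of_le (hH : H.Connected) {u w : X} {i : ℕ} (hi : i ≤ H.dist u w) :
    ∃ v, H.dist u v = i := by
  induction hi using Nat.decreasingInduction with
  | self => exact ⟨w, rfl⟩
  | of_succ j _ ih =>
    obtain ⟨x, hx⟩ := ih
    obtain ⟨v, -, hv⟩ := exists_adj_dist_eq hH hx
    exact ⟨v, hv⟩

theorem two_mul_card_le_card_adj_dist_ne [Fintype X] [DecidableRel H.Adj] (hH : H.Connected)
    (v : X) :
    2 * Fintype.card X ≤ #{p : X × X | H.Adj p.1 p.2 ∧ H.dist v p.1 ≠ H.dist v p.2} + 2 := by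
  classical
  set down : Finset (X × X) := {p | H.Adj p.1 p.2 ∧ H.dist v p.1 < H.dist v p.2}
  set up : Finset (X × X) := {p | H.Adj p.1 p.2 ∧ H.dist v p.2 < H.dist v p.1}
  have hdown : Fintype.card X ≤ #down + 1 := by
    rw [← Finset.card_univ, ← Finset.card_erase_add_one (Finset.mem_univ v)]
    refine Nat.add_le_add_right (Finset.card_le_card_of_surjOn Prod.snd fun w hw => ?_) 1
    have hpos : 0 < H.dist v w :=
      hH.pos_dist_of_ne (Finset.ne_of_mem_erase (Finset.mem_coe.1 hw)).symm
    obtain ⟨x, hadj, hx⟩ := exists_adj_dist_eq hH (Nat.succ_pred_eq_of_pos hpos).symm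
    exact ⟨(x, w), by simpa [down, hadj, hx] using hpos, rfl⟩
  have hup : #up = #down := Finset.card_equiv (Equiv.prodComm X X) fun p => by
    simp [up, down, H.adj_comm]
  have hdisj : Disjoint down up := Finset.disjoint_filter.2 fun p _ h h' => by lia
  have hunion : down ∪ up ⊆
      ({p | H.Adj p.1 p.2 ∧ H.dist v p.1 ≠ H.dist v p.2} : Finset (X × X)) := by
    intro p
    simp only [down, up, Finset.mem_union, Finset.mem_filter_univ]
    grind
  have := Finset.card_le_card hunion
  rw [Finset.card_union_of_disjoint hdisj] at this
  lia

theorem hammingDist_le_dist_mul {Z κ : Type*} [Fintype Z] [DecidableEq κ] (hH : H.Connected)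
    {f : X → Z → κ} {m : ℕ} (hf : ∀ u w, H.Adj u w → hammingDist (f u) (f w) ≤ m) (u w : X) :
    hammingDist (f u) (f w) ≤ H.dist u w * m := by
  obtain ⟨p, hp⟩ := hH.exists_walk_length_eq_dist u w
  rw [← hp]
  clear hp
  induction p with
  | nil => simp
  | @cons u v w hadj p ih =>
    rw [Walk.length_cons, add_mul, one_mul, add_comm]
    exact (hammingDist_triangle _ (f v) _).trans (add_le_add (hf u v hadj) ih)

end GraphDistance

theorem exists_equiv_of_card_fiber_eq {α β γ : Type*} [Fintype α] [Fintype β] [DecidableEq γ]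
    {f : α → γ} {g : β → γ} (h : ∀ c, #{a | f a = c} = #{b | g b = c}) :
    ∃ e : α ≃ β, ∀ a, g (e a) = f a := by
  have hfib (c : γ) : Nonempty ({a // f a = c} ≃ {b // g b = c}) :=
    ⟨Fintype.equivOfCardEq (by simpa only [Fintype.card_subtype] using h c)⟩
  exact ⟨Equiv.ofFiberEquiv fun c => (hfib c).some, fun a => Equiv.ofFiberEquiv_map _ a⟩

/-- The graph joining distinct `u`, `w` when `c u w = a` or `c w u = a`; for the distance function
of a graph this is its distance-`a` graph. -/
def colorGraph {X ι : Type*} (c : X → X → ι) (a : ι) : SimpleGraph X :=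
  SimpleGraph.fromRel fun u w => c u w = a

/-- A symmetric association scheme on `X`, encoded by the function giving the class of each pair.
The diagonal is a single class, and the classes of `(u, v)` and `(w, v)` are distributed, as `v`
varies, in a way depending only on the class of `(u, w)`. Thus `hammingDist (c u) (c w)` is the
number of `v` that tell `u` and `w` apart. -/
structure IsSymmScheme {X ι : Type*} [Fintype X] [DecidableEq ι] (c : X → X → ι) : Prop where
  symm : ∀ u w, c u w = c w u
  diag : ∀ u v w, c u v = c w w ↔ u = v
  card_eq : ∀ {u w u' w'}, c u w = c u' w' → ∀ i j,
    #{v | c u v = i ∧ c w v = j} = #{v | c u' v = i ∧ c w' v = j}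

namespace IsSymmScheme

variable {X ι : Type*} [Fintype X] [DecidableEq ι] {c : X → X → ι} {a : ι} {u w u' w' : X}

theorem colorGraph_adj (hc : IsSymmScheme c) : (colorGraph c a).Adj u w ↔ u ≠ w ∧ c u w = a := by
  simp [colorGraph, hc.symm w u]

theorem exists_perm_of_color_eq (hc : IsSymmScheme c) (h : c u w = c u' w') :
    ∃ e : Equiv.Perm X, ∀ v, c u' (e v) = c u v ∧ c w' (e v) = c w v := by
  obtain ⟨e, he⟩ := exists_equiv_of_card_fiber_eq (f := fun v => (c u v, c w v))
    (g := fun v => (c u' v, c w' v)) fun ij => by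
      simpa only [Prod.ext_iff] using hc.card_eq h ij.1 ij.2
  exact ⟨e, fun v => Prod.ext_iff.1 (he v)⟩

theorem eq_iff_eq_of_color_eq (hc : IsSymmScheme c) (h : c u w = c u' w') :
    u = w ↔ u' = w' := by
  rw [← hc.diag u w u, h, hc.diag]

theorem colorGraph_adj_congr (hc : IsSymmScheme c) (h : c u w = c u' w') :
    (colorGraph c a).Adj u w ↔ (colorGraph c a).Adj u' w' := by
  rw [hc.colorGraph_adj, hc.colorGraph_adj, h, ne_eq, hc.eq_iff_eq_of_color_eq h]

theorem card_color_eq (hc : IsSymmScheme c) (u u' : X) (a : ι) :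
    #{v | c u v = a} = #{v | c u' v = a} := by
  simpa only [and_self] using hc.card_eq ((hc.diag u u u').2 rfl) a a

theorem hammingDist_congr (hc : IsSymmScheme c) (h : c u w = c u' w') :
    hammingDist (c u) (c w) = hammingDist (c u') (c w') := by
  obtain ⟨e, he⟩ := hc.exists_perm_of_color_eq h
  exact Finset.card_equiv e fun v => by simp [he]

theorem restrict (hc : IsSymmScheme c) {s : Set X} [Fintype s] {E : ι → Prop}
    (hs : ∀ u ∈ s, ∀ v, v ∈ s ↔ E (c u v)) : IsSymmScheme fun x y : s => c x y where
  symm x y := hc.symm x y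
  diag x y z := by rw [hc.diag, Subtype.ext_iff]
  card_eq {x y x' y'} h i j := by
    obtain ⟨e, he⟩ := hc.exists_perm_of_color_eq h
    have hmem (v : X) : v ∈ s ↔ e v ∈ s := by
      rw [hs x x.2, hs x' x'.2, (he v).1]
    exact Finset.card_equiv (e.subtypeEquiv hmem) fun v => by
      simp [Equiv.subtypeEquiv_apply, he]

theorem exists_walk_of_color_eq (hc : IsSymmScheme c) (p : (colorGraph c a).Walk u w)
    (h : c u w = c u' w') : ∃ q : (colorGraph c a).Walk u' w', q.length = p.length := by
  induction p generalizing u' w' with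
  | nil =>
    obtain rfl : u' = w' := (hc.eq_iff_eq_of_color_eq h).1 rfl
    exact ⟨.nil, rfl⟩
  | @cons u v w hadj p ih =>
    obtain ⟨e, he⟩ := hc.exists_perm_of_color_eq h
    have hvw : c v w = c (e v) w' := by rw [hc.symm, hc.symm (e v), (he v).2]
    obtain ⟨q, hq⟩ := ih hvw
    exact ⟨.cons ((hc.colorGraph_adj_congr (he v).1).2 hadj) q, by simp [hq]⟩

theorem colorGraph_dist_congr (hc : IsSymmScheme c) (h : c u w = c u' w') :
    (colorGraph c a).dist u w = (colorGraph c a).dist u' w' := by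
  rw [dist_eq_sInf, dist_eq_sInf]
  congr 1
  ext m
  exact ⟨fun ⟨p, hp⟩ => (hc.exists_walk_of_color_eq p h).imp fun _ hq => hq.trans hp,
    fun ⟨p, hp⟩ => (hc.exists_walk_of_color_eq p h.symm).imp fun _ hq => hq.trans hp⟩

theorem dist_le_card_colors (hc : IsSymmScheme c) (hconn : (colorGraph c a).Connected)
    {S : Finset ι} (hS : ∀ u w, u ≠ w → c u w ∈ S) (u w : X) : (colorGraph c a).dist u w ≤ #S := by
  have hex (s : ℕ) : ∃ v, s ≤ (colorGraph c a).dist u w → (colorGraph c a).dist u v = s := by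
    by_cases hs : s ≤ (colorGraph c a).dist u w
    · exact (exists_dist_eq_of_le hconn hs).imp fun _ hv _ => hv
    · exact ⟨u, fun h => absurd h hs⟩
  choose v hv using hex
  rw [← Nat.add_sub_cancel (n := (colorGraph c a).dist u w) (m := 1), ← Nat.card_Icc]
  refine Finset.card_le_card_of_injOn (fun s => c u (v s)) (fun s hs => ?_) fun s hs t ht hst => ?_
  · rw [Finset.coe_Icc] at hs
    refine hS u (v s) fun heq => ?_
    have := hv s hs.2
    rw [← heq, dist_self] at this
    exact absurd hs.1 (by lia)
  · rw [Finset.coe_Icc] at hs ht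
    rw [← hv s hs.2, ← hv t ht.2, hc.colorGraph_dist_congr hst]

theorem card_mul_card_le_of_hammingDist_le (hc : IsSymmScheme c)
    (hconn : (colorGraph c a).Connected) {S : Finset ι} (hS : ∀ u w, u ≠ w → c u w ∈ S)
    {Z κ : Type*} [Fintype Z] [DecidableEq κ] {f : X → Z → κ} {m M : ℕ}
    (hf : ∀ u w, c u w = a → hammingDist (f u) (f w) ≤ m)
    (hM : ∀ z i, #{w | f w z = i} ≤ M) :
    Fintype.card Z * Fintype.card X ≤ Fintype.card X * (#S * m) + Fintype.card Z * M := by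
  obtain ⟨u⟩ := hconn.nonempty
  have hsum : ∑ w, hammingDist (f u) (f w) = ∑ z, #{w | f u z ≠ f w z} := by
    simp only [hammingDist, Finset.card_filter]
    exact Finset.sum_comm
  have hupper : ∑ w, hammingDist (f u) (f w) ≤ Fintype.card X * (#S * m) := by
    refine (Finset.sum_le_card_nsmul _ _ (#S * m) fun w _ => ?_).trans_eq (by simp)
    calc hammingDist (f u) (f w)
      _ ≤ (colorGraph c a).dist u w * m :=
        hammingDist_le_dist_mul hconn (fun x y h => hf x y (hc.colorGraph_adj.1 h).2) u w
      _ ≤ #S * m := Nat.mul_le_mul_right m (hc.dist_le_card_colors hconn hS u w)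
  calc Fintype.card Z * Fintype.card X
    _ = ∑ z : Z, (#{w | f u z ≠ f w z} + #{w | f w z = f u z}) := by
      simp_rw [eq_comm (b := f u _), add_comm (#{w | f u _ ≠ f w _}),
        Finset.card_filter_add_card_filter_not]
      simp
    _ = ∑ w, hammingDist (f u) (f w) + ∑ z : Z, #{w | f w z = f u z} := by
      rw [Finset.sum_add_distrib, hsum]
    _ ≤ Fintype.card X * (#S * m) + Fintype.card Z * M := by
      refine add_le_add hupper ?_
      exact (Finset.sum_le_card_nsmul _ _ _ fun z _ => hM z _).trans_eq (by simp)

theorem two_mul_card_sub_one_le (hc : IsSymmScheme c)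
    (hconn : (colorGraph c (c u w)).Connected) :
    2 * (Fintype.card X - 1) ≤ #{v | c u v = c u w} * hammingDist (c u) (c w) := by
  classical
  set a := c u w
  set pairs : Finset (X × X) := {p | c p.1 p.2 = a}
  have hpairs : #pairs = Fintype.card X * #{v | c u v = a} := by
    rw [Finset.card_filter, Fintype.sum_prod_type]
    simp_rw [← Finset.card_filter, hc.card_color_eq _ u a]
    simp
  have hlower (v : X) : 2 * (Fintype.card X - 1) ≤ #{p ∈ pairs | c p.1 v ≠ c p.2 v} := by
    have hsub : ({p | (colorGraph c a).Adj p.1 p.2 ∧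
        (colorGraph c a).dist v p.1 ≠ (colorGraph c a).dist v p.2} : Finset (X × X)) ⊆
        {p ∈ pairs | c p.1 v ≠ c p.2 v} := by
      refine fun p hp => ?_
      simp only [pairs, Finset.mem_filter, Finset.mem_univ, true_and, hc.colorGraph_adj] at hp ⊢
      refine ⟨hp.1.2, mt (fun h => hc.colorGraph_dist_congr ?_) hp.2⟩
      rw [hc.symm, h, hc.symm]
    have := (two_mul_card_le_card_adj_dist_ne hconn v).trans
      (Nat.add_le_add_right (Finset.card_le_card hsub) 2)
    lia
  have hcount : ∑ v, #{p ∈ pairs | c p.1 v ≠ c p.2 v} = #pairs * hammingDist (c u) (c w) := by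
    simp only [Finset.card_filter]
    rw [Finset.sum_comm]
    refine Finset.sum_const_nat fun p hp => ?_
    rw [← Finset.card_filter]
    exact hc.hammingDist_congr (Finset.mem_filter.1 hp).2
  have hpos : 0 < Fintype.card X := Fintype.card_pos_iff.2 ⟨u⟩
  refine Nat.le_of_mul_le_mul_left ?_ hpos
  calc Fintype.card X * (2 * (Fintype.card X - 1))
    _ ≤ ∑ v, #{p ∈ pairs | c p.1 v ≠ c p.2 v} := by
      simpa using Finset.card_nsmul_le_sum Finset.univ _ _ fun v _ => hlower v
    _ = Fintype.card X * (#{v | c u v = a} * hammingDist (c u) (c w)) := by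
      rw [hcount, hpairs, mul_assoc]

theorem two_mul_card_eq_and_ne_le_hammingDist (hc : IsSymmScheme c) (a : ι) (u w : X) :
    2 * #{v | c w v = a ∧ c u v ≠ a} ≤ hammingDist (c u) (c w) := by
  classical
  have hcard : #{v | c w v = a ∧ c u v ≠ a} = #{v | c u v = a ∧ c w v ≠ a} := by
    have hu := Finset.card_filter_add_card_filter_not (s := {v | c u v = a}) (c w · = a)
    have hw := Finset.card_filter_add_card_filter_not (s := {v | c w v = a}) (c u · = a)
    rw [hc.card_color_eq w u a] at hw
    simp only [Finset.filter_filter] at hu hw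
    simp only [and_comm (a := c w _ = a) (b := c u _ = a)] at hw
    lia
  rw [two_mul]
  nth_rw 1 [hcard]
  rw [← Finset.card_union_of_disjoint (Finset.disjoint_filter.2 fun v _ h h' => h.2 h'.1)]
  refine Finset.card_le_card fun v => ?_
  simp only [Finset.mem_union, Finset.mem_filter_univ]
  grind

theorem two_mul_card_color_le (hc : IsSymmScheme c) (a : ι) (u w : X) :
    2 * #{v | c u v = a} ≤ 2 * #{v | c u v = a ∧ c w v = a} + hammingDist (c u) (c w) := by
  have hsplit := Finset.card_filter_add_card_filter_not (s := {v | c w v = a}) (c u · = a)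
  rw [hc.card_color_eq w u a] at hsplit
  simp only [Finset.filter_filter, and_comm (a := c w _ = a) (b := c u _ = a)] at hsplit
  have := hc.two_mul_card_eq_and_ne_le_hammingDist a u w
  lia

theorem hammingDist_le_two_mul (hc : IsSymmScheme c) (hconn : (colorGraph c (c u w)).Connected)
    (hsmall : 2 * hammingDist (c u) (c w) ≤ #{v | c u v = c u w}) (x y : X) :
    hammingDist (c x) (c y) ≤ 2 * hammingDist (c u) (c w) := by
  classical
  set a := c u w with ha
  have hadj {x y : X} (h : c x y = a) : hammingDist (c x) (c y) = hammingDist (c u) (c w) :=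
    hc.hammingDist_congr h
  have hpos : 0 < #{v | c u v = a} := Finset.card_pos.2 ⟨w, by simp [ha]⟩
  have hclose {x y : X} (h : hammingDist (c x) (c y) ≤ 3 * hammingDist (c u) (c w)) :
      hammingDist (c x) (c y) ≤ 2 * hammingDist (c u) (c w) := by
    obtain ⟨v, hv⟩ : ({v | c x v = a ∧ c y v = a} : Finset X).Nonempty := by
      by_contra hempty
      have hcommon := hc.two_mul_card_color_le a x y
      rw [Finset.not_nonempty_iff_eq_empty.1 hempty, Finset.card_empty,
        hc.card_color_eq x u a] at hcommon
      lia
    obtain ⟨hxv, hyv⟩ := (Finset.mem_filter_univ v).1 hv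
    have := hammingDist_triangle (c x) (c v) (c y)
    rw [hadj hxv, hammingDist_comm (c v), hadj hyv] at this
    lia
  obtain ⟨p⟩ := hconn x y
  induction p with
  | nil => simp
  | @cons x v y h _ ih =>
    refine hclose ((hammingDist_triangle _ (c v) _).trans ?_)
    rw [hadj (hc.colorGraph_adj.1 h).2]
    lia

theorem card_color_ne_lt_hammingDist (hc : IsSymmScheme c) (hne : u ≠ w)
    (hconn : (colorGraph c (c u w)).Connected)
    (hsmall : 2 * hammingDist (c u) (c w) ≤ #{v | c u v = c u w}) :
    #{v | c u v ≠ c u w} < hammingDist (c u) (c w) := by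
  classical
  set a := c u w
  set γ := hammingDist (c u) (c w)
  set N : Finset X := {v | c u v = a}
  set C : Finset X := {v | c u v ≠ a}
  have hγ : 0 < γ := hammingDist_pos.2 fun h => hne ((hc.diag u w w).1 (congrFun h w))
  have hupper : ∀ v ∈ N, 2 * #{z ∈ C | c z v = a} ≤ γ := fun v hv => by
    refine le_of_le_of_eq ?_ (hc.hammingDist_congr ((Finset.mem_filter_univ v).1 hv))
    simpa only [C, Finset.filter_filter, and_comm, hc.symm v] using
      hc.two_mul_card_eq_and_ne_le_hammingDist a u v
  have hlower (z : X) : #N ≤ #{v ∈ N | c z v = a} + γ := by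
    have := (hc.two_mul_card_color_le a u z).trans
      (Nat.add_le_add_left (hc.hammingDist_le_two_mul hconn hsmall u z) _)
    rw [Finset.filter_filter]
    lia
  have hu : #N < #{v ∈ N | c u v = a} + γ := by
    simpa [N, Finset.filter_filter] using hγ
  -- Double count the pairs `(z, v)` in `C × N` of class `a`.
  have hdouble : ∑ z ∈ C, #{v ∈ N | c z v = a} = ∑ v ∈ N, #{z ∈ C | c z v = a} :=
    Finset.sum_card_bipartiteAbove_eq_sum_card_bipartiteBelow fun z v => c z v = a
  have hlt : #C * #N < ∑ z ∈ C, #{v ∈ N | c z v = a} + #C * γ := by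
    rw [← smul_eq_mul, ← smul_eq_mul, ← Finset.sum_const, ← Finset.sum_const,
      ← Finset.sum_add_distrib]
    have hmem : u ∈ C := (Finset.mem_filter_univ u).2 fun h => hne ((hc.diag u w u).1 h.symm)
    exact Finset.sum_lt_sum (fun z _ => hlower z) ⟨u, hmem, hu⟩
  have hle : 2 * ∑ v ∈ N, #{z ∈ C | c z v = a} ≤ #N * γ := by
    rw [Finset.mul_sum, ← smul_eq_mul]
    exact Finset.sum_le_card_nsmul _ _ _ hupper
  rw [hdouble] at hlt
  by_contra! hγC
  have h₁ : 2 * γ * #C ≤ #N * #C := Nat.mul_le_mul_right _ hsmall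
  have h₂ : #N * γ ≤ #N * #C := Nat.mul_le_mul_left _ hγC
  nlinarith

theorem card_color_eq_le_sq (hc : IsSymmScheme c) (hne : u ≠ w) {b : ι} (hb : b ≠ c u w)
    (hconn : (colorGraph c b).Connected) :
    #{v | c u v = c u w} ≤ #{v | c u v ≠ c u w} ^ 2 := by
  classical
  set a := c u w
  obtain ⟨x, y, z, hxy, hxz, hzy⟩ : ∃ x y z, c x y = a ∧ c x z ≠ a ∧ c z y ≠ a := by
    by_contra! htrans
    have hwalk {x y : X} (p : (colorGraph c b).Walk x y) : c x y ≠ a := by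
      induction p with
      | @nil x => exact fun h => hne ((hc.eq_iff_eq_of_color_eq h).1 rfl)
      | @cons x z y hadj _ ih =>
        exact fun h => ih (htrans x y z h ((hc.colorGraph_adj.1 hadj).2.trans_ne hb))
    obtain ⟨p⟩ := hconn u w
    exact hwalk p rfl
  have hcard (z : X) : #{v | c z v ≠ a} = #{v | c u v ≠ a} := by
    have hu := Finset.card_filter_add_card_filter_not (s := Finset.univ) (c u · = a)
    have hz := Finset.card_filter_add_card_filter_not (s := Finset.univ) (c z · = a)
    rw [hc.card_color_eq z u a] at hz
    lia
  have hsub : ({v | c u v = a} : Finset X) ⊆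
      ({z | c u z ≠ a} : Finset X).biUnion fun z => {v | c z v ≠ a} := fun v hv => by
    obtain ⟨e, he⟩ := hc.exists_perm_of_color_eq (hxy.trans (Finset.mem_filter_univ v |>.1 hv).symm)
    refine Finset.mem_biUnion.2 ⟨e z, ?_⟩
    simp only [Finset.mem_filter_univ, (he z).1, hc.symm (e z), (he z).2, hc.symm y]
    exact ⟨hxz, hzy⟩
  calc #{v | c u v = a}
    _ ≤ _ := Finset.card_le_card hsub
    _ ≤ #{v | c u v ≠ a} ^ 2 := by
      rw [sq]
      exact Finset.card_biUnion_le_card_mul _ _ _ fun z _ => (hcard z).le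

theorem card_le_hammingDist_sq (hc : IsSymmScheme c) (hne : u ≠ w)
    (hconn : (colorGraph c (c u w)).Connected) {b : ι} (hb : b ≠ c u w)
    (hconn' : (colorGraph c b).Connected) :
    Fintype.card X ≤ hammingDist (c u) (c w) ^ 2 := by
  have hcard : #{v | c u v = c u w} + #{v | c u v ≠ c u w} = Fintype.card X :=
    Finset.card_filter_add_card_filter_not _
  have hγ : 0 < hammingDist (c u) (c w) :=
    hammingDist_pos.2 fun h => hne ((hc.diag u w w).1 (congrFun h w))
  have hvalency := hc.two_mul_card_sub_one_le hconn
  by_cases hsmall : 2 * hammingDist (c u) (c w) ≤ #{v | c u v = c u w}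
  · have hne_lt := hc.card_color_ne_lt_hammingDist hne hconn hsmall
    have heq_le := hc.card_color_eq_le_sq hne hb hconn'
    nlinarith
  · have : #{v | c u v = c u w} * hammingDist (c u) (c w) + hammingDist (c u) (c w) ≤
        2 * hammingDist (c u) (c w) ^ 2 := by
      rw [← Nat.succ_mul, sq, ← mul_assoc]
      exact Nat.mul_le_mul_right _ (by lia)
    lia

end IsSymmScheme

section BoseMesner

variable {V : Type*} {G : SimpleGraph V}

/-- The matrices whose entries depend only on the distance between their indices; for a
distance-regular graph this is the underlying vector space of its Bose–Mesner algebra. -/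
def boseMesner (G : SimpleGraph V) : Submodule ℚ (Matrix V V ℚ) where
  carrier := {M | ∀ u v u' v', G.dist u v = G.dist u' v' → M u v = M u' v'}
  add_mem' hM hN u v u' v' h := by simp [hM u v u' v' h, hN u v u' v' h]
  zero_mem' _ _ _ _ _ := rfl
  smul_mem' q M hM u v u' v' h := by simp [hM u v u' v' h]

/-- The adjacency matrix of the distance-`i` relation of `G`. -/
noncomputable def distMatrix (G : SimpleGraph V) (i : ℕ) : Matrix V V ℚ :=
  .of fun u v => if G.dist u v = i then 1 else 0

theorem distMatrix_mem_boseMesner (i : ℕ) : distMatrix G i ∈ boseMesner G :=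
  fun u v u' v' h => by simp [distMatrix, h]

theorem eq_sum_smul_distMatrix {M : Matrix V V ℚ} (hM : M ∈ boseMesner G) {m : ℕ}
    (hzero : ∀ u v, m ≤ G.dist u v → M u v = 0) :
    ∃ q : ℕ → ℚ, M = ∑ i ∈ Finset.range m, q i • distMatrix G i := by
  obtain ⟨q, hq⟩ := (Function.factorsThrough_iff (f := fun p : V × V => G.dist p.1 p.2)
    fun p => M p.1 p.2).1 fun p p' h => hM p.1 p.2 p'.1 p'.2 h
  refine ⟨q, Matrix.ext fun u v => ?_⟩
  have huv : M u v = q (G.dist u v) := congrFun hq (u, v)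
  simp only [Matrix.sum_apply, Matrix.smul_apply, distMatrix, Matrix.of_apply, smul_eq_mul,
    mul_ite, mul_one, mul_zero, Finset.sum_ite_eq, Finset.mem_range]
  split_ifs with h
  · exact huv
  · exact hzero u v (not_lt.1 h)

variable [Fintype V]

theorem distMatrix_mul_adjMatrix_apply [DecidableRel G.Adj] (j : ℕ) (u w : V) :
    (distMatrix G j * G.adjMatrix ℚ) u w = {v | G.Adj w v ∧ G.dist u v = j}.ncard := by
  simp only [mul_adjMatrix_apply, distMatrix, Matrix.of_apply, Finset.sum_boole]
  rw [← Set.ncard_coe_finset]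
  simp

theorem mul_adjMatrix_mem_boseMesner [DecidableRel G.Adj] (hG : G.IsDistanceRegular)
    {M : Matrix V V ℚ} (hM : M ∈ boseMesner G) : M * G.adjMatrix ℚ ∈ boseMesner G := by
  have := hG.1.nonempty
  obtain ⟨q, rfl⟩ := eq_sum_smul_distMatrix hM (m := G.diam + 1) fun u v h =>
    absurd (dist_le_diam (connected_iff_ediam_ne_top.1 hG.1)) (not_le.2 h)
  rw [Finset.sum_mul]
  refine Submodule.sum_mem _ fun j _ => ?_
  rw [Matrix.smul_mul]
  refine Submodule.smul_mem _ _ fun u w u' w' h => ?_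
  rw [distMatrix_mul_adjMatrix_apply, distMatrix_mul_adjMatrix_apply, hG.2 u w u' w' h]

theorem distMatrix_mul_adjMatrix_apply_eq_zero [DecidableRel G.Adj] (hG : G.Connected) {j : ℕ}
    {u w : V} (h : j + 2 ≤ G.dist u w) : (distMatrix G j * G.adjMatrix ℚ) u w = 0 := by
  rw [distMatrix_mul_adjMatrix_apply, Nat.cast_eq_zero, Set.ncard_eq_zero]
  refine Set.eq_empty_of_forall_notMem fun v ⟨hadj, hv⟩ => ?_
  have := hG.dist_triangle (u := u) (v := v) (w := w)
  rw [hv, dist_eq_one_iff_adj.2 (G.adj_symm hadj)] at this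
  lia

theorem distMatrix_mul_adjMatrix_apply_ne_zero [DecidableRel G.Adj] (hG : G.Connected) {j : ℕ}
    {u w : V} (h : G.dist u w = j + 1) : (distMatrix G j * G.adjMatrix ℚ) u w ≠ 0 := by
  obtain ⟨v, hadj, hv⟩ := exists_adj_dist_eq hG h
  rw [distMatrix_mul_adjMatrix_apply, Nat.cast_ne_zero]
  exact Set.ncard_ne_zero_of_mem (a := v) ⟨G.adj_symm hadj, hv⟩

theorem mul_distMatrix_mem_boseMesner (hG : G.IsDistanceRegular) (j : ℕ)
    {M : Matrix V V ℚ} (hM : M ∈ boseMesner G) : M * distMatrix G j ∈ boseMesner G := by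
  classical
  induction j using Nat.strong_induction_on generalizing M with
  | h j ih =>
  cases j with
  | zero =>
    have hone : distMatrix G 0 = 1 := by
      ext u v
      simp [distMatrix, Matrix.one_apply, hG.1.dist_eq_zero_iff]
    rwa [hone, mul_one]
  | succ j =>
  -- `A_j A` is a nonzero multiple of `A_{j+1}` plus a combination of the earlier `A_i`.
  by_cases hex : ∃ u w, G.dist u w = j + 1
  · obtain ⟨u, w, huw⟩ := hex
    obtain ⟨q, hq⟩ := eq_sum_smul_distMatrix
      (mul_adjMatrix_mem_boseMesner hG (distMatrix_mem_boseMesner j))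
      fun x y => distMatrix_mul_adjMatrix_apply_eq_zero hG.1
    have hq0 : q (j + 1) ≠ 0 := fun hq0 => by
      refine distMatrix_mul_adjMatrix_apply_ne_zero hG.1 huw ?_
      rw [hq]
      simp [Matrix.sum_apply, distMatrix, huw, hq0]
    have hmem : M * distMatrix G j * G.adjMatrix ℚ ∈ boseMesner G :=
      mul_adjMatrix_mem_boseMesner hG (ih j j.lt_succ_self hM)
    rw [mul_assoc, hq, Finset.mul_sum, Finset.sum_range_succ, Submodule.add_mem_iff_right,
      Matrix.mul_smul, Submodule.smul_mem_iff _ hq0] at hmem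
    · exact hmem
    · refine Submodule.sum_mem _ fun i hi => ?_
      rw [Matrix.mul_smul]
      exact Submodule.smul_mem _ _ (ih i (Finset.mem_range.1 hi) hM)
  · have hzero : distMatrix G (j + 1) = 0 :=
      Matrix.ext fun u w => if_neg fun h => hex ⟨u, w, h⟩
    rw [hzero, mul_zero]
    exact Submodule.zero_mem _

theorem isSymmScheme_dist (hG : G.IsDistanceRegular) : IsSymmScheme G.dist where
  symm _ _ := dist_comm
  diag u v w := by rw [dist_self, hG.1.dist_eq_zero_iff]
  card_eq {u w u' w'} h i j := by
    have hcount (x y : V) : (distMatrix G i * distMatrix G j) x y =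
        #{v | G.dist x v = i ∧ G.dist y v = j} := by
      simp only [Matrix.mul_apply, distMatrix, Matrix.of_apply, ← ite_and, mul_ite, mul_one,
        mul_zero, dist_comm (v := y)]
      simp [and_comm]
    have := mul_distMatrix_mem_boseMesner hG j (distMatrix_mem_boseMesner i) u w u' w' h
    rw [hcount, hcount] at this
    exact_mod_cast this

end BoseMesner

section Halves

variable {V : Type*} {G : SimpleGraph V}

theorem even_dist_iff (hbip : G.IsBipartite) (hG : G.Connected) (u v w : V) :
    Even (G.dist u w) ↔ (Even (G.dist u v) ↔ Even (G.dist w v)) := by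
  let side : G.Coloring Bool := Colorable.toColoring hbip (by simp)
  have hside (x y : V) : Even (G.dist x y) ↔ (side x ↔ side y) := by
    obtain ⟨p, hp⟩ := hG.exists_walk_length_eq_dist x y
    rw [← hp]
    exact side.even_length_iff_congr p
  rw [hside, hside, hside]
  tauto

theorem exists_halvedGraph_walk (hG : G.Connected) {C : G.HalvedIndex} {x y : V} (hx : x ∈ C.supp)
    {m : ℕ} (h : G.dist x y = 2 * m) :
    ∃ hy : y ∈ C.supp, ∃ p : (G.halvedGraph C).Walk ⟨x, hx⟩ ⟨y, hy⟩, p.length = m := by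
  induction m generalizing y with
  | zero =>
    obtain rfl := hG.dist_eq_zero_iff.1 h
    exact ⟨hx, .nil, rfl⟩
  | succ m ih =>
    obtain ⟨v, hvy, hxv⟩ := exists_adj_dist_eq hG (j := 2 * m + 1) h
    obtain ⟨z, hzv, hxz⟩ := exists_adj_dist_eq hG hxv
    obtain ⟨hz, p, hp⟩ := ih hxz
    have hle : G.dist z y ≤ 2 := by
      have := hG.dist_triangle (u := z) (v := v) (w := y)
      rwa [dist_eq_one_iff_adj.2 hzv, dist_eq_one_iff_adj.2 hvy] at this
    have hge : G.dist x y ≤ G.dist x z + G.dist z y := hG.dist_triangle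
    have hdist : G.dist z y = 2 := by lia
    have hadj : (G.distanceGraph 2).Adj z y := ⟨fun h => by simp [h] at hdist, hdist⟩
    have hy : y ∈ C.supp := (C.mem_supp_congr_adj hadj).1 hz
    have hadj' : (G.halvedGraph C).Adj ⟨z, hz⟩ ⟨y, hy⟩ := hadj
    exact ⟨hy, p.concat hadj', by rw [Walk.length_concat, hp]⟩

theorem dist_le_two_mul_length (hG : G.Connected) {C : G.HalvedIndex} {x y : C.supp}
    (p : (G.halvedGraph C).Walk x y) : G.dist x y ≤ 2 * p.length := by
  induction p with
  | nil => simp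
  | @cons x z y hadj p ih =>
    have htri : G.dist x y ≤ G.dist x z + G.dist z y := hG.dist_triangle
    have hxz : G.dist x z = 2 := hadj.2
    rw [Walk.length_cons]
    lia

theorem mem_supp_iff_even_dist (hbip : G.IsBipartite) (hG : G.Connected) {C : G.HalvedIndex}
    {x : V} (hx : x ∈ C.supp) (y : V) : y ∈ C.supp ↔ Even (G.dist x y) := by
  refine ⟨fun hy => ?_, fun ⟨m, hm⟩ => (exists_halvedGraph_walk hG hx (hm.trans (by ring))).1⟩
  obtain ⟨p⟩ := C.reachable_of_mem_supp hx hy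
  clear hx hy
  induction p with
  | nil => simp
  | @cons x z y hadj p ih =>
    rw [even_dist_iff hbip hG x z y, hadj.2, dist_comm]
    simpa using ih

theorem halvedGraph_connected (hbip : G.IsBipartite) (hG : G.Connected) (C : G.HalvedIndex) :
    (G.halvedGraph C).Connected := by
  have := C.nonempty_supp.to_subtype
  refine ⟨fun x y => ?_⟩
  obtain ⟨m, hm⟩ := (mem_supp_iff_even_dist hbip hG x.2 y).1 y.2
  obtain ⟨_, p, _⟩ := exists_halvedGraph_walk hG x.2 (hm.trans (by ring : m + m = 2 * m))
  exact ⟨p⟩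

theorem dist_eq_two_mul_halvedGraph_dist (hbip : G.IsBipartite) (hG : G.Connected)
    {C : G.HalvedIndex} (x y : C.supp) : G.dist x y = 2 * (G.halvedGraph C).dist x y := by
  obtain ⟨m, hm⟩ := (mem_supp_iff_even_dist hbip hG x.2 y).1 y.2
  obtain ⟨_, p, hp⟩ := exists_halvedGraph_walk hG x.2 (hm.trans (by ring : m + m = 2 * m))
  obtain ⟨q, hq⟩ := (halvedGraph_connected hbip hG C).exists_walk_length_eq_dist x y
  have hle : (G.halvedGraph C).dist x y ≤ p.length := dist_le p
  have hge := dist_le_two_mul_length hG q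
  lia

theorem colorGraph_half_connected [Finite V] (hbip : G.IsBipartite) (hG : G.Connected)
    {C : G.HalvedIndex} (hC : (G.halvedGraph C).IsPrimitive) {u w : C.supp} (hne : u ≠ w) :
    (colorGraph (fun x y : C.supp => G.dist x y) (G.dist u w)).Connected := by
  have hconn := halvedGraph_connected hbip hG C
  have := hconn.nonempty
  convert hC ((G.halvedGraph C).dist u w) (hconn.pos_dist_of_ne hne)
    (dist_le_diam (connected_iff_ediam_ne_top.1 hconn)) using 1
  ext x y
  refine (fromRel_adj _ x y).trans ?_
  simp only [G.dist_comm (u := y) (v := x), or_self]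
  simp [distanceGraph, dist_eq_two_mul_halvedGraph_dist hbip hG]

end Halves

section Counting

variable {V : Type*} {G : SimpleGraph V}

theorem exists_dist_eq_of_le_diam [Finite V] (hG : G.IsDistanceRegular) (u : V) {i : ℕ}
    (hi : i ≤ G.diam) : ∃ v, G.dist u v = i := by
  have := Fintype.ofFinite V
  have := hG.1.nonempty
  obtain ⟨x, y, hxy⟩ := G.exists_dist_eq_diam
  obtain ⟨v, hv⟩ := exists_dist_eq_of_le hG.1 (hi.trans hxy.ge)
  obtain ⟨e, he⟩ := (isSymmScheme_dist hG).exists_perm_of_color_eq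
    (show G.dist x x = G.dist u u by rw [dist_self, dist_self])
  exact ⟨e v, (he v).1.trans hv⟩

theorem isSymmScheme_half [Finite V] (hG : G.IsDistanceRegular) (hbip : G.IsBipartite)
    (C : G.HalvedIndex) [Fintype C.supp] : IsSymmScheme fun x y : C.supp => G.dist x y :=
  have := Fintype.ofFinite V
  (isSymmScheme_dist hG).restrict fun _ hu => mem_supp_iff_even_dist hbip hG.1 hu

variable [Fintype V]

theorem two_mul_card_even_dist_iff (hG : G.IsDistanceRegular) (hbip : G.IsBipartite)
    (hd : 1 ≤ G.diam) (u : V) (i : ℕ) :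
    2 * #{w | Even (G.dist u w) ↔ Even i} = Fintype.card V := by
  obtain ⟨y, hy⟩ := exists_dist_eq_of_le_diam hG u hd
  obtain ⟨e, he⟩ := (isSymmScheme_dist hG).exists_perm_of_color_eq
    (show G.dist u u = G.dist y y by rw [dist_self, dist_self])
  have hcompl : #{w | Even (G.dist u w) ↔ Even i} = #{w | ¬(Even (G.dist u w) ↔ Even i)} := by
    refine Finset.card_equiv e fun w => ?_
    have := even_dist_iff hbip hG.1 u y (e w)
    rw [hy, dist_comm (u := e w), (he w).1] at this
    simp only [Finset.mem_filter_univ, this, Nat.not_even_one, false_iff]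
    tauto
  rw [two_mul]
  nth_rw 2 [hcompl]
  exact Finset.card_filter_add_card_filter_not _

theorem card_sphere_le_maxSphereCard (hG : G.Connected) (v : V) (i : ℕ) :
    #{w | G.dist v w = i} ≤ G.maxSphereCard := by
  have := hG.nonempty
  by_cases hi : i ≤ G.diam
  · rw [← Set.toFinset_ofPred, ← Set.ncard_eq_toFinset_card', maxSphereCard]
    exact (Finset.le_sup (f := fun i : ℕ => {w : V | G.dist v w = i}.ncard)
      (Finset.mem_range_succ_iff.2 hi)).trans (Finset.le_sup (f := fun v : V =>
        (Finset.range (G.diam + 1)).sup fun i : ℕ => {w : V | G.dist v w = i}.ncard)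
          (Finset.mem_univ v))
  · rw [Finset.filter_false_of_mem]
    · exact Nat.zero_le _
    · rintro w - rfl
      exact hi (dist_le_diam (connected_iff_ediam_ne_top.1 hG))

theorem two_mul_maxSphereCard_lt_card (hG : G.IsDistanceRegular) (hbip : G.IsBipartite)
    (hd : 3 ≤ G.diam) : 2 * G.maxSphereCard < Fintype.card V := by
  have hsphere (v : V) (i : ℕ) : 2 * #{w | G.dist v w = i} < Fintype.card V := by
    obtain ⟨j, hj, hji, hpar⟩ : ∃ j ≤ 3, j ≠ i ∧ (Even j ↔ Even i) :=
      ⟨if i ≤ 1 then i + 2 else i % 2, by grind⟩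
    obtain ⟨z, hz⟩ := exists_dist_eq_of_le_diam hG v (hj.trans hd)
    rw [← two_mul_card_even_dist_iff hG hbip (by lia) v i]
    refine Nat.mul_lt_mul_of_pos_left (Finset.card_lt_card
      (Finset.ssubset_iff_of_subset (fun w hw => ?_) |>.2 ⟨z, ?_, ?_⟩)) two_pos
    · simp_all
    · simpa [hz] using hpar
    · simpa [hz] using hji
  have := hG.1.nonempty
  obtain ⟨v, -, hv⟩ := Finset.exists_mem_eq_sup _ Finset.univ_nonempty fun v : V =>
    (Finset.range (G.diam + 1)).sup fun i : ℕ => {w : V | G.dist v w = i}.ncard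
  obtain ⟨i, -, hi⟩ := Finset.exists_mem_eq_sup (Finset.range (G.diam + 1)) (by simp)
    fun i : ℕ => {w : V | G.dist v w = i}.ncard
  rw [maxSphereCard, hv, hi, Set.ncard_eq_toFinset_card', Set.toFinset_ofPred]
  exact hsphere v i

theorem eight_le_card_of_four_le_diam (hG : G.IsDistanceRegular) (hbip : G.IsBipartite)
    (hd : 4 ≤ G.diam) : 8 ≤ Fintype.card V := by
  classical
  obtain ⟨u⟩ := hG.1.nonempty
  obtain ⟨y, huy⟩ := exists_dist_eq_of_le_diam hG u hd
  obtain ⟨x, hxy, hux⟩ := exists_adj_dist_eq hG.1 huy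
  obtain ⟨z, hzx, huz⟩ := exists_adj_dist_eq hG.1 hux
  have hne : u ≠ y := fun h => by simp [h] at huy
  have hzy : G.dist z y = 2 := by
    have hle := hG.1.dist_triangle (u := z) (v := x) (w := y)
    have hge := hG.1.dist_triangle (u := u) (v := z) (w := y)
    rw [dist_eq_one_iff_adj.2 hzx, dist_eq_one_iff_adj.2 hxy] at hle
    lia
  have hpair : {u, y} ⊆ ({w | G.dist z w = 2} : Finset V) := by
    refine Finset.insert_subset ?_ (Finset.singleton_subset_iff.2 ?_)
    · simpa [dist_comm] using huz
    · simpa using hzy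
  have htwo : 2 ≤ #{w | G.dist u w = 2} := by
    rw [(isSymmScheme_dist hG).card_color_eq u z]
    simpa [Finset.card_pair hne] using Finset.card_le_card hpair
  have hsub : insert u (insert y ({w | G.dist u w = 2} : Finset V)) ⊆
      ({w | Even (G.dist u w) ↔ Even 0} : Finset V) := by
    refine Finset.insert_subset ?_ (Finset.insert_subset ?_ fun w hw => ?_) <;>
      simp_all [show Even 4 by decide]
  have hcard := Finset.card_le_card hsub
  rw [Finset.card_insert_of_notMem (by simp [hne]),
    Finset.card_insert_of_notMem (by simp [huy])] at hcard
  have := two_mul_card_even_dist_iff hG hbip (by lia) u 0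
  lia

theorem two_mul_card_supp (hG : G.IsDistanceRegular) (hbip : G.IsBipartite) (hd : 1 ≤ G.diam)
    (C : G.HalvedIndex) [Fintype C.supp] : 2 * Fintype.card C.supp = Fintype.card V := by
  obtain ⟨u, hu⟩ := C.nonempty_supp
  rw [← two_mul_card_even_dist_iff hG hbip hd u 0, Fintype.card_of_subtype]
  simp [mem_supp_iff_even_dist hbip hG.1 hu]

end Counting

section DistinguishingVertices

variable {V : Type*} {G : SimpleGraph V} [Fintype V] {C : G.HalvedIndex}

theorem card_le_two_mul_hammingDist_sq (hG : G.IsDistanceRegular) (hbip : G.IsBipartite)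
    (hd : 4 ≤ G.diam) (hC : (G.halvedGraph C).IsPrimitive) {u w : C.supp} (hne : u ≠ w) :
    Fintype.card V ≤ 2 * hammingDist (G.dist u) (G.dist w) ^ 2 := by
  have := Fintype.ofFinite C.supp
  obtain ⟨i, hi, hpos, heven, hiuw⟩ : ∃ i ≤ 4, 0 < i ∧ Even i ∧ i ≠ G.dist u w :=
    ⟨if G.dist u w = 2 then 4 else 2, by grind⟩
  obtain ⟨y, hy⟩ := exists_dist_eq_of_le_diam hG u (hi.trans hd)
  lift y to C.supp using (mem_supp_iff_even_dist hbip hG.1 u.2 y).2 (hy ▸ heven)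
  have huy : u ≠ y := fun h => hpos.ne' (by rw [← hy, h, dist_self])
  rw [← two_mul_card_supp hG hbip (by lia) C]
  refine Nat.mul_le_mul_left 2 (((isSymmScheme_half hG hbip C).card_le_hammingDist_sq hne
    (colorGraph_half_connected hbip hG.1 hC hne) (hy ▸ hiuw)
    (colorGraph_half_connected hbip hG.1 hC huy)).trans (Nat.pow_le_pow_left ?_ 2))
  exact Finset.card_le_card_of_injOn Subtype.val (fun v hv => by simpa using hv)
    Subtype.val_injective.injOn

theorem two_mul_card_le_diam_mul_hammingDist (hG : G.IsDistanceRegular) (hbip : G.IsBipartite)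
    (hd : 1 ≤ G.diam) (hC : (G.halvedGraph C).IsPrimitive) {u w : C.supp} (hne : u ≠ w) :
    2 * Fintype.card V ≤ G.diam * hammingDist (G.dist u) (G.dist w) + 4 * G.maxSphereCard := by
  have := Fintype.ofFinite C.supp
  have := hG.1.nonempty
  set S : Finset ℕ := (Finset.Icc 1 (G.diam / 2)).image (2 * ·)
  have hS (x y : C.supp) (hxy : x ≠ y) : G.dist x y ∈ S := by
    have hdist := dist_eq_two_mul_halvedGraph_dist hbip hG.1 x y
    have hle : G.dist x y ≤ G.diam := dist_le_diam (connected_iff_ediam_ne_top.1 hG.1)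
    have hpos := (halvedGraph_connected hbip hG.1 C).pos_dist_of_ne hxy
    exact Finset.mem_image.2 ⟨_, Finset.mem_Icc.2 ⟨hpos, by lia⟩, hdist.symm⟩
  have hcardS : #S ≤ G.diam / 2 := Finset.card_image_le.trans (by simp)
  have hfiber (z : V) (i : ℕ) : #{x : C.supp | G.dist x z = i} ≤ G.maxSphereCard := by
    refine le_trans ?_ (card_sphere_le_maxSphereCard hG.1 z i)
    exact Finset.card_le_card_of_injOn Subtype.val (fun x hx => by simpa [dist_comm] using hx)
      Subtype.val_injective.injOn
  have hcard := two_mul_card_supp hG hbip hd C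
  have hbound := (isSymmScheme_half hG hbip C).card_mul_card_le_of_hammingDist_le
    (colorGraph_half_connected hbip hG.1 hC hne) hS (f := fun x : C.supp => G.dist x)
    (fun x y h => ((isSymmScheme_dist hG).hammingDist_congr h).le) hfiber
  rw [← hcard] at hbound ⊢
  have hpos : 0 < Fintype.card C.supp := Fintype.card_pos_iff.2 ⟨u⟩
  have hhalf : 2 * Fintype.card C.supp ≤
      #S * hammingDist (G.dist u) (G.dist w) + 2 * G.maxSphereCard :=
    Nat.le_of_mul_le_mul_left (by linarith) hpos
  have hmul : 2 * #S * hammingDist (G.dist u) (G.dist w) ≤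
      G.diam * hammingDist (G.dist u) (G.dist w) := Nat.mul_le_mul_right _ (by lia)
  linarith

end DistinguishingVertices

theorem exists_card_forall_not_le {α Z : Type*} [Fintype Z] [Nonempty Z] (P : Finset α)
    (r : α → Z → Prop) [∀ p, DecidablePred (r p)] {y : ℝ}
    (hr : ∀ p ∈ P, (#{z | ¬ r p z} : ℝ) ≤ y * Fintype.card Z) (k : ℕ) :
    ∃ f : Fin k → Z, (#{p ∈ P | ∀ i, ¬ r p (f i)} : ℝ) ≤ #P * y ^ k := by
  have hcard (p : α) : #{f : Fin k → Z | ∀ i, ¬ r p (f i)} = #{z | ¬ r p z} ^ k := by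
    rw [← Fintype.card_piFinset_const]
    congr 1
    ext f
    simp
  suffices hsum : ∑ f : Fin k → Z, (#{p ∈ P | ∀ i, ¬ r p (f i)} : ℝ) ≤
      ∑ _f : Fin k → Z, #P * y ^ k by
    obtain ⟨f, -, hf⟩ := Finset.exists_le_of_sum_le Finset.univ_nonempty hsum
    exact ⟨f, hf⟩
  calc ∑ f : Fin k → Z, (#{p ∈ P | ∀ i, ¬ r p (f i)} : ℝ)
      = ∑ p ∈ P, (#{z | ¬ r p z} : ℝ) ^ k := by
        have h := Finset.sum_card_bipartiteAbove_eq_sum_card_bipartiteBelow (s := Finset.univ)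
          (t := P) fun (f : Fin k → Z) p => ∀ i, ¬ r p (f i)
        simp only [Finset.bipartiteAbove, Finset.bipartiteBelow, hcard] at h
        exact_mod_cast h
    _ ≤ ∑ _p ∈ P, (y * Fintype.card Z) ^ k :=
        Finset.sum_le_sum fun p hp => pow_le_pow_left₀ (Nat.cast_nonneg _) (hr p hp) k
    _ = ∑ _f : Fin k → Z, #P * y ^ k := by
        simp only [Finset.sum_const, nsmul_eq_mul, Finset.card_univ, Fintype.card_fun,
          Fintype.card_fin, Nat.cast_pow]
        ring

theorem one_sub_le_exp_neg_add_sq {x : ℝ} (h0 : 0 ≤ x) (h1 : x < 1) :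
    1 - x ≤ Real.exp (-(x + x ^ 2 / 2)) := by
  have hseries := Real.hasSum_pow_div_log_of_abs_lt_one (x := x) (by rwa [abs_of_nonneg h0])
  have hpartial := sum_le_hasSum (Finset.range 2) (fun i _ => by positivity) hseries
  norm_num [Finset.sum_range_succ] at hpartial
  rw [← Real.log_le_iff_le_exp (by linarith)]
  linarith

theorem mul_one_sub_pow_lt_one {N k : ℕ} {x : ℝ} (hN : 4 ≤ N) (h0 : 0 < x) (h1 : x ≤ 1 / 2)
    (hk : 2 * Real.log N / x ≤ k + 1) : (N : ℝ) * (N - 1) * (1 - x) ^ k < 1 := by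
  have hN' : (4 : ℝ) ≤ N := by exact_mod_cast hN
  have hlog : 5 / 4 ≤ Real.log N := by
    have hmono : Real.log 4 ≤ Real.log N := Real.log_le_log (by norm_num) hN'
    have hfour : Real.log 4 = 2 * Real.log 2 := by
      rw [show (4 : ℝ) = 2 ^ 2 by norm_num, Real.log_pow, Nat.cast_two]
    linarith [Real.log_two_gt_d9]
  -- The second-order term makes up for `k` being one less than `2 * log N / x`.
  have hexponent : 2 * Real.log N ≤ k * (x + x ^ 2 / 2) := by
    rw [div_le_iff₀ h0] at hk
    calc 2 * Real.log N ≤ 2 * Real.log N * (1 + x / 2) - (x + x ^ 2 / 2) := by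
          nlinarith [mul_nonneg h0.le (sub_nonneg.2 hlog), mul_nonneg h0.le (sub_nonneg.2 h1)]
      _ ≤ (k + 1) * x * (1 + x / 2) - (x + x ^ 2 / 2) := by gcongr
      _ = k * (x + x ^ 2 / 2) := by ring
  have hpow : (1 - x) ^ k ≤ ((N : ℝ) ^ 2)⁻¹ := by
    calc (1 - x) ^ k ≤ Real.exp (-(x + x ^ 2 / 2)) ^ k :=
          pow_le_pow_left₀ (by linarith) (one_sub_le_exp_neg_add_sq h0.le (by linarith)) k
      _ ≤ Real.exp (-(2 * Real.log N)) := by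
          rw [← Real.exp_nat_mul, Real.exp_le_exp]
          linarith
      _ = ((N : ℝ) ^ 2)⁻¹ := by
          rw [Real.exp_neg, two_mul, Real.exp_add, Real.exp_log (by linarith), sq]
  calc (N : ℝ) * (N - 1) * (1 - x) ^ k ≤ N * (N - 1) * ((N : ℝ) ^ 2)⁻¹ :=
        mul_le_mul_of_nonneg_left hpow (mul_nonneg (by linarith) (by linarith))
    _ < 1 := by
        rw [← div_eq_mul_inv, div_lt_one (by positivity)]
        nlinarith


section MetricDimension

variable {V : Type*} {G : SimpleGraph V}

theorem metricDim_le_card {R : Finset V} (hR : G.IsResolvingSet R) : G.metricDim ≤ #R :=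
  Nat.sInf_le ⟨R, hR, rfl⟩

theorem card_ne_and_even_dist [Fintype V] [DecidableEq V] {N : ℕ}
    (hhalf : ∀ u, #{w | Even (G.dist u w)} = N) :
    #{p : V × V | p.1 ≠ p.2 ∧ Even (G.dist p.1 p.2)} = Fintype.card V * (N - 1) := by
  have hfiber (u : V) : #{w | u ≠ w ∧ Even (G.dist u w)} = N - 1 := by
    rw [← hhalf u, ← Finset.card_erase_of_mem (a := u) (by simp)]
    congr 1
    ext w
    simp [ne_comm]
  rw [← Finset.card_univ, ← smul_eq_mul, ← Finset.sum_const, ← Finset.sum_congr rfl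
    fun u _ => hfiber u, ← Finset.card_sigma]
  exact Finset.card_equiv (Equiv.sigmaEquivProd V V).symm (by simp)

theorem isResolvingSet_of_card_unresolved_lt_two [Fintype V] [DecidableEq V]
    (hbip : G.IsBipartite) (hG : G.Connected) {R : Finset V} (hR : R.Nonempty)
    (hlt : #{p : V × V | (p.1 ≠ p.2 ∧ Even (G.dist p.1 p.2)) ∧
      ∀ z ∈ R, G.dist p.1 z = G.dist p.2 z} < 2) : G.IsResolvingSet R := by
  intro u w hne
  by_contra! hno
  obtain ⟨z, hz⟩ := hR
  have heven : Even (G.dist u w) := by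
    rw [even_dist_iff hbip hG u z w, hno z hz]
  refine hlt.not_ge (Finset.one_lt_card.2 ⟨(u, w), ?_, (w, u), ?_, by simp [hne]⟩)
  · simpa using ⟨⟨hne, heven⟩, hno⟩
  · simpa [dist_comm] using ⟨⟨hne.symm, heven⟩, fun z hz => (hno z hz).symm⟩

theorem metricDim_le_of_mul_pow_lt_one [Fintype V] (hbip : G.IsBipartite) (hG : G.Connected)
    {N k : ℕ} (hhalf : ∀ u, #{w | Even (G.dist u w)} = N) (hcard : Fintype.card V = 2 * N)
    (hN : 2 ≤ N) {x : ℝ}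
    (hres : ∀ u w, u ≠ w → Even (G.dist u w) →
      x * Fintype.card V ≤ hammingDist (G.dist u) (G.dist w))
    (hlt : (N : ℝ) * (N - 1) * (1 - x) ^ k < 1) : G.metricDim ≤ k := by
  classical
  have := hG.nonempty
  have hkpos : 0 < k := by
    refine Nat.pos_of_ne_zero fun h => hlt.not_ge ?_
    have hN' : (2 : ℝ) ≤ N := by exact_mod_cast hN
    rw [h, pow_zero]
    nlinarith
  have hunresolved : ∀ p ∈ ({p | p.1 ≠ p.2 ∧ Even (G.dist p.1 p.2)} : Finset (V × V)),
      (#{z | ¬G.dist p.1 z ≠ G.dist p.2 z} : ℝ) ≤ (1 - x) * Fintype.card V := by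
    intro p hp
    obtain ⟨hne, heven⟩ := (Finset.mem_filter_univ p).1 hp
    have hsplit := Finset.card_filter_add_card_filter_not (s := Finset.univ)
      fun z => G.dist p.1 z ≠ G.dist p.2 z
    rw [Finset.card_univ, ← @Nat.cast_inj ℝ, Nat.cast_add] at hsplit
    linarith [(hres p.1 p.2 hne heven).trans_eq (by rw [hammingDist])]
  obtain ⟨f, hf⟩ := exists_card_forall_not_le _ _ hunresolved k
  rw [card_ne_and_even_dist hhalf, Finset.filter_filter] at hf
  have hresolving : G.IsResolvingSet (Finset.univ.image f) := by
    refine isResolvingSet_of_card_unresolved_lt_two hbip hG ⟨f ⟨0, hkpos⟩, by simp⟩ ?_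
    rw [← Nat.cast_lt (α := ℝ)]
    calc _ ≤ ((Fintype.card V * (N - 1) : ℕ) : ℝ) * (1 - x) ^ k := by simpa using hf
      _ = 2 * (N * (N - 1) * (1 - x) ^ k) := by
          push_cast [hcard, Nat.cast_sub (by lia : 1 ≤ N)]
          ring
      _ < (2 : ℕ) := by
          push_cast
          linarith
  simpa using (metricDim_le_card hresolving).trans Finset.card_image_le

theorem metricDim_lt_two_mul_log_div [Fintype V] (hbip : G.IsBipartite) (hG : G.Connected)
    (hhalf : ∀ u, 2 * #{w | Even (G.dist u w)} = Fintype.card V) (hcard : 8 ≤ Fintype.card V)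
    {x : ℝ} (h0 : 0 < x) (h1 : x ≤ 1 / 2)
    (hres : ∀ u w, u ≠ w → Even (G.dist u w) →
      x * Fintype.card V ≤ hammingDist (G.dist u) (G.dist w)) :
    (G.metricDim : ℝ) < 2 * Real.log (Fintype.card V / 2) / x := by
  have := hG.nonempty
  obtain ⟨N, hN⟩ : ∃ N, Fintype.card V = 2 * N := ⟨_, (hhalf (Classical.arbitrary V)).symm⟩
  rw [show (Fintype.card V : ℝ) / 2 = N by rw [hN]; push_cast; ring]
  set B := 2 * Real.log N / x
  have hB : 0 < B :=
    div_pos (mul_pos two_pos (Real.log_pos (by exact_mod_cast (by lia : 1 < N)))) h0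
  obtain ⟨k, hk⟩ : ∃ k, ⌈B⌉₊ = k + 1 := Nat.exists_eq_succ_of_ne_zero (Nat.ceil_pos.2 hB).ne'
  have hkB : (k : ℝ) < B := Nat.lt_ceil.1 (by lia)
  have hBk : B ≤ k + 1 := by exact_mod_cast Nat.ceil_le.1 hk.le
  have hle : G.metricDim ≤ k :=
    metricDim_le_of_mul_pow_lt_one hbip hG (fun u => by have := hhalf u; lia) hN (by lia) hres
      (mul_one_sub_pow_lt_one (by lia) h0 h1 hBk)
  exact hkB.trans_le' (by exact_mod_cast hle)

end MetricDimension

theorem div_sqrt_half {x : ℝ} (hx : 0 < x) : x / √(x / 2) = √(2 * x) := by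
  rw [div_eq_iff (by positivity), ← Real.sqrt_mul (by positivity),
    show 2 * x * (x / 2) = x ^ 2 by ring, Real.sqrt_sq hx.le]

theorem metricDim_lt_of_le_hammingDist_on_halves {V : Type*} [Fintype V] {G : SimpleGraph V}
    (hG : G.IsDistanceRegular) (hbip : G.IsBipartite) (hd : 4 ≤ G.diam) {a : ℝ} (h0 : 0 < a)
    (h1 : a ≤ Fintype.card V / 2)
    (hres : ∀ (C : G.HalvedIndex) (u w : C.supp), u ≠ w →
      a ≤ hammingDist (G.dist u) (G.dist w)) :
    (G.metricDim : ℝ) < 2 * (Fintype.card V / a) * Real.log (Fintype.card V / 2) := by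
  have hn : (0 : ℝ) < Fintype.card V := by linarith
  refine (metricDim_lt_two_mul_log_div (x := a / Fintype.card V) hbip hG.1 (fun u => ?_)
    (eight_le_card_of_four_le_diam hG hbip hd) (by positivity) ?_
    fun u w hne heven => ?_).trans_eq ?_
  · simpa using two_mul_card_even_dist_iff hG hbip (by lia) u 0
  · rw [div_le_iff₀ hn]
    linarith
  · let C := (G.distanceGraph 2).connectedComponentMk u
    have hu : u ∈ C.supp := ConnectedComponent.connectedComponentMk_mem
    have hw : w ∈ C.supp := (mem_supp_iff_even_dist hbip hG.1 hu w).2 heven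
    rw [div_mul_cancel₀ a hn.ne']
    exact hres C ⟨u, hu⟩ ⟨w, hw⟩ (by simpa using hne)
  · field_simp

theorem mainTheorem10 {V : Type*} [Fintype V] (G : SimpleGraph V)
    (hbip : G.IsBipartite) (hdr : G.IsDistanceRegular) (hdiam : 4 ≤ G.diam)
    (hprim : ∀ C : G.HalvedIndex, (G.halvedGraph C).IsPrimitive ∧ 2 ≤ (G.halvedGraph C).diam) :
    (G.metricDim : ℝ) <
        2 * Real.sqrt (2 * (Fintype.card V : ℝ)) * Real.log ((Fintype.card V : ℝ) / 2) ∧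
      (G.metricDim : ℝ) <
        (G.diam : ℝ) *
            ((Fintype.card V : ℝ) / ((Fintype.card V : ℝ) - 2 * (G.maxSphereCard : ℝ))) *
          Real.log ((Fintype.card V : ℝ) / 2) := by
  have hn : (8 : ℝ) ≤ Fintype.card V := by
    exact_mod_cast eight_le_card_of_four_le_diam hdr hbip hdiam
  have hd : (4 : ℝ) ≤ G.diam := by exact_mod_cast hdiam
  constructor
  · rw [← div_sqrt_half (by linarith)]
    refine metricDim_lt_of_le_hammingDist_on_halves hdr hbip hdiam (by positivity)
      (Real.sqrt_le_iff.2 ⟨by positivity, by nlinarith⟩) fun C u w hne => ?_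
    have hle : (Fintype.card V : ℝ) ≤ 2 * hammingDist (G.dist u) (G.dist w) ^ 2 := by
      exact_mod_cast card_le_two_mul_hammingDist_sq hdr hbip hdiam (hprim C).1 hne
    exact Real.sqrt_le_iff.2 ⟨by positivity, by linarith⟩
  · have hpos : 0 < (Fintype.card V : ℝ) - 2 * G.maxSphereCard :=
      sub_pos.2 (by exact_mod_cast two_mul_maxSphereCard_lt_card hdr hbip (by lia))
    have hbound := metricDim_lt_of_le_hammingDist_on_halves hdr hbip hdiam
      (a := 2 * (Fintype.card V - 2 * G.maxSphereCard) / G.diam) (by positivity) ?_ ?_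
    · convert hbound using 2
      field_simp
    · rw [div_le_iff₀ (by positivity)]
      nlinarith [(Nat.cast_nonneg G.maxSphereCard : (0 : ℝ) ≤ _)]
    · intro C u w hne
      have hle : (2 * Fintype.card V : ℝ) ≤
          G.diam * hammingDist (G.dist u) (G.dist w) + 4 * G.maxSphereCard := by
        exact_mod_cast two_mul_card_le_diam_mul_hammingDist hdr hbip (by lia) (hprim C).1 hne
      exact (div_le_iff₀' (by positivity)).2 (by linarith)
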